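/- Let $\mathfrak H$ be a right quaternionic Hilbert space (inner product $\langle\cdot|\cdot\rangle$, right-linear in the second variable) with a Hilbert basis $(e_n)_{n\ge 0}$. For a quaternion $\mathfrak q$ let $\mathfrak q\cdot\phi=\sum_{k}e_k\,\mathfrak q\,\langle e_k|\phi\rangle$ be the left multiplication induced by this basis, and for a right-linear operator $A$ put $(\mathfrak q\cdot A)\phi=\mathfrak q\cdot(A\phi)$. Let $$\mathsf a=\sum_{m\ge0}\sqrt{m+1}\,|e_m\rangle\langle e_{m+1}|,\qquad \mathsf a^\dagger=\sum_{m\ge0}\sqrt{m+1}\,|e_{m+1}\rangle\langle e_m|$$ be the annihilation and creation operators, each with its natural domain (the vectors on which the series converges). For $\mathfrak x\in\mathbb H$ let $D(\mathfrak x)=e^{\mathfrak x\cdot\mathsf a^\dagger-\overline{\mathfrak x}\cdot\mathsf a}$ be the displacement operator; here $e^{A}$ denotes the closure of the operator $\phi\mapsto\sum_{k\ge0}\frac1{k!}A^k\phi$, defined on all $\phi$ in the domain of every power of $A$ for which the series converges unconditionally. Then for every $\mathfrak x\in\mathbb H$ $$\text{(i)}\quad D(\mathfrak x)^\dagger\,\mathsf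 a\,D(\mathfrak x)=\mathsf a+\mathfrak x\cdot\mathbb I_{\mathfrak H},\qquad \text{(ii)}\quad D(\mathfrak x)^\dagger\,\mathsf a^\dagger D(\mathfrak x)=\mathsf a^\dagger+\overline{\mathfrak x}\cdot\mathbb I_{\mathfrak H},$$ as equalities of unbounded operators, including equality of the domains. -/

import Mathlib

open scoped Quaternion RightActions

noncomputable section

namespace Quaternionic

/-- A right quaternionic inner product space: a right vector space over the quaternions (a module
over `ℍᵐᵒᵖ`, with `φ <• q` denoting `φ q`) with a quaternion-valued inner product that induces the
given norm. Together with `CompleteSpace H` this is a right quaternionic Hilbert space. -/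
class RightInnerProductSpace (H : Type*) [NormedAddCommGroup H] extends Module ℍᵐᵒᵖ H where
  /-- the inner product `⟨f | g⟩` -/
  qinner : H → H → ℍ
  star_qinner : ∀ f g : H, star (qinner f g) = qinner g f
  qinner_self : ∀ f : H, qinner f f = ((‖f‖ ^ 2 : ℝ) : ℍ)
  qinner_add : ∀ f g h : H, qinner f (g + h) = qinner f g + qinner f h
  qinner_smul : ∀ (f g : H) (q : ℍ), qinner f (g <• q) = qinner f g * q

open RightInnerProductSpace

variable {H : Type*} [NormedAddCommGroup H] [RightInnerProductSpace H]

theorem add_qinner (f g h : H) : qinner (f + g) h = qinner f h + qinner g h := by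
  rw [← star_qinner, qinner_add, star_add, star_qinner, star_qinner]

theorem smul_qinner (f g : H) (q : ℍ) : qinner (f <• q) g = star q * qinner f g := by
  rw [← star_qinner, qinner_smul, star_mul, star_qinner]

theorem norm_rsmul (f : H) (q : ℍ) : ‖f <• q‖ = ‖f‖ * ‖q‖ := by
  have h := qinner_self (f <• q)
  rw [qinner_smul, smul_qinner, qinner_self, mul_assoc, Quaternion.coe_mul_eq_smul,
    mul_smul_comm, Quaternion.star_mul_self, Quaternion.normSq_eq_norm_mul_self,
    Quaternion.smul_coe] at h
  have h2 := Quaternion.coe_injective h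
  rw [← sq_eq_sq₀ (norm_nonneg _) (by positivity), ← h2]
  ring

instance : ContinuousConstSMul ℍᵐᵒᵖ H where
  continuous_const_smul c := by
    have h : ∀ f : H, ‖DistribSMul.toAddMonoidHom H c f‖ ≤ ‖c.unop‖ * ‖f‖ := fun f => by
      have := norm_rsmul f c.unop
      simp only [MulOpposite.op_unop] at this
      simp [this, mul_comm]
    exact AddMonoidHomClass.continuous_of_bound (DistribSMul.toAddMonoidHom H c) _ h

/-- The rank one operator `|u⟩ c ⟨v|`, that is `φ ↦ u (c ⟨v | φ⟩)`. -/
def ketBra (u : H) (c : ℍ) (v : H) : H →ₗ[ℍᵐᵒᵖ] H where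
  toFun φ := u <• (c * qinner v φ)
  map_add' φ ψ := by rw [qinner_add, mul_add, MulOpposite.op_add, add_smul]
  map_smul' q φ := by
    obtain ⟨q, rfl⟩ := MulOpposite.op_surjective q
    rw [qinner_smul, ← mul_assoc, MulOpposite.op_mul, mul_smul, RingHom.id_apply]

variable (H) in
/-- A Hilbert basis `(e n)`, `n = 0, 1, 2, …`: an orthonormal sequence whose right quaternionic
span is dense. -/
structure HilbertSeqBasis where
  toFun : ℕ → H
  orthonormal : ∀ m n, qinner (toFun m) (toFun n) = if m = n then 1 else 0
  dense : Dense (Submodule.span ℍᵐᵒᵖ (Set.range toFun) : Set H)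

instance : CoeFun (HilbertSeqBasis H) fun _ => ℕ → H := ⟨HilbertSeqBasis.toFun⟩

theorem qinner_sum_right (f : H) (s : Finset ℕ) (g : ℕ → H) :
    qinner f (∑ k ∈ s, g k) = ∑ k ∈ s, qinner f (g k) :=
  map_sum (AddMonoidHom.mk' (fun g => qinner f g) (qinner_add f)) g s

theorem qinner_basis_sum (e : HilbertSeqBasis H) (s : Finset ℕ) (c : ℕ → ℍ) {j : ℕ}
    (hj : j ∈ s) : qinner (e j) (∑ k ∈ s, e k <• c k) = c j := by
  simp [qinner_sum_right, qinner_smul, e.orthonormal, hj]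

theorem coe_sum (s : Finset ℕ) (c : ℕ → ℝ) :
    ((∑ k ∈ s, c k : ℝ) : ℍ) = ∑ k ∈ s, (c k : ℍ) :=
  map_sum (algebraMap ℝ ℍ) c s

/-- Pythagoras for finite combinations of basis vectors. -/
theorem norm_sq_sum (e : HilbertSeqBasis H) (s : Finset ℕ) (c : ℕ → ℍ) :
    ‖∑ k ∈ s, e k <• c k‖ ^ 2 = ∑ k ∈ s, ‖c k‖ ^ 2 := by
  apply Quaternion.coe_injective
  rw [← qinner_self, qinner_sum_right, coe_sum]
  refine Finset.sum_congr rfl fun j hj => ?_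
  rw [qinner_smul, ← star_qinner, qinner_basis_sum e s c hj, Quaternion.star_mul_self,
    Quaternion.normSq_eq_norm_mul_self, sq]

/-- Bessel's inequality. -/
theorem bessel (e : HilbertSeqBasis H) (s : Finset ℕ) (φ : H) :
    ∑ k ∈ s, ‖qinner (e k) φ‖ ^ 2 ≤ ‖φ‖ ^ 2 := by
  set S := ∑ k ∈ s, e k <• qinner (e k) φ with hS
  have h1 : qinner φ S = ((‖S‖ ^ 2 : ℝ) : ℍ) := by
    rw [norm_sq_sum, hS, qinner_sum_right, coe_sum]
    refine Finset.sum_congr rfl fun j _ => ?_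
    rw [qinner_smul, ← star_qinner, Quaternion.star_mul_self, Quaternion.normSq_eq_norm_mul_self,
      sq]
  have h2 : qinner φ φ = qinner (φ - S) (φ - S) + qinner φ S := by
    have h3 : qinner S φ = qinner S S := by
      rw [← star_qinner, h1, qinner_self]; simp
    have h4 : qinner (φ - S) φ = qinner (φ - S) (φ - S) + qinner (φ - S) S := by
      rw [← qinner_add, sub_add_cancel]
    have h5 : ∀ g : H, qinner φ g = qinner (φ - S) g + qinner S g := fun g => by
      rw [← add_qinner, sub_add_cancel]
    rw [h5 φ, h4, h3, h5 S, add_assoc]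
  rw [qinner_self, qinner_self, h1, ← Quaternion.coe_add] at h2
  have h3 := Quaternion.coe_injective h2
  rw [← norm_sq_sum e, ← hS]
  nlinarith [sq_nonneg ‖φ - S‖]

theorem summable_ketBra [CompleteSpace H] (e : HilbertSeqBasis H) (q : ℍ) (φ : H) :
    Summable fun k => ketBra (e k) q (e k) φ := by
  have hs : Summable fun k => ‖q * qinner (e k) φ‖ ^ 2 := by
    simp only [norm_mul, mul_pow]
    exact (summable_of_sum_le (fun _ => by positivity) (fun s => bessel e s φ)).mul_left _
  rw [summable_iff_vanishing_norm] at hs ⊢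
  intro ε hε
  obtain ⟨s, h⟩ := hs (ε ^ 2) (by positivity)
  refine ⟨s, fun t ht => ?_⟩
  have h1 := (le_abs_self _).trans_lt (h t ht)
  rw [← norm_sq_sum e] at h1
  exact lt_of_pow_lt_pow_left₀ 2 hε.le h1

/-- Left multiplication by `q` induced by the basis `e`:
`q · φ = ∑ₖ eₖ q ⟨eₖ | φ⟩`. As an operator it is `q · 𝕀`. -/
def leftMul [CompleteSpace H] (e : HilbertSeqBasis H) (q : ℍ) : H →ₗ[ℍᵐᵒᵖ] H where
  toFun φ := ∑' k, ketBra (e k) q (e k) φ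
  map_add' φ ψ := by
    simp only [map_add]
    exact (summable_ketBra e q φ).tsum_add (summable_ketBra e q ψ)
  map_smul' c φ := by
    simp only [map_smul, RingHom.id_apply]
    exact (summable_ketBra e q φ).tsum_const_smul c

/-- The operator `∑ₖ Tₖ` with its natural domain, the vectors `φ` for which `∑ₖ Tₖ φ` converges. -/
def seriesOp (T : ℕ → H →ₗ[ℍᵐᵒᵖ] H) : H →ₗ.[ℍᵐᵒᵖ] H where
  domain :=
    { carrier := {φ | Summable fun k => T k φ}
      add_mem' := fun {φ ψ} hφ hψ => by
        simp only [Set.mem_ofPred_eq, map_add] at *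
        exact hφ.add hψ
      zero_mem' := by simp
      smul_mem' := fun c φ hφ => by
        simp only [Set.mem_ofPred_eq, map_smul] at *
        exact hφ.const_smul c }
  toFun :=
    { toFun := fun φ => ∑' k, T k φ
      map_add' := fun φ ψ => by
        simp only [Submodule.coe_add, map_add]
        exact Summable.tsum_add φ.2 ψ.2
      map_smul' := fun c φ => by
        simp only [Submodule.coe_smul, map_smul, RingHom.id_apply]
        exact Summable.tsum_const_smul c φ.2 }

/-- The annihilation operator `a = ∑ₘ √(m+1) |eₘ⟩⟨eₘ₊₁|`. -/
def annihilation (e : HilbertSeqBasis H) : H →ₗ.[ℍᵐᵒᵖ] H :=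
  seriesOp fun m => ketBra (e m) ((√(m + 1) : ℝ) : ℍ) (e (m + 1))

/-- The creation operator `a† = ∑ₘ √(m+1) |eₘ₊₁⟩⟨eₘ|`. -/
def creation (e : HilbertSeqBasis H) : H →ₗ.[ℍᵐᵒᵖ] H :=
  seriesOp fun m => ketBra (e (m + 1)) ((√(m + 1) : ℝ) : ℍ) (e m)

/-- The product `S T` of unbounded operators, with domain `{φ ∈ dom T | T φ ∈ dom S}`. -/
def opComp (S T : H →ₗ.[ℍᵐᵒᵖ] H) : H →ₗ.[ℍᵐᵒᵖ] H :=
  S.comp (T.domRestrict ((S.domain.comap T.toFun).map T.domain.subtype)) (by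
    rintro ⟨φ, ⟨⟨ψ, hψ, rfl⟩, -⟩⟩
    exact hψ)

/-- The adjoint `T†` of a densely defined operator: `T† ψ = η` if and only if
`⟨η | φ⟩ = ⟨ψ | T φ⟩` for all `φ` in the domain of `T`. -/
def opAdjoint (T : H →ₗ.[ℍᵐᵒᵖ] H) : H →ₗ.[ℍᵐᵒᵖ] H :=
  Submodule.toLinearPMap
    { carrier := {p : H × H | ∀ φ : T.domain, qinner p.2 (φ : H) = qinner p.1 (T φ)}
      add_mem' := fun {p r} hp hr φ => by
        simp only [Prod.fst_add, Prod.snd_add, add_qinner, hp φ, hr φ]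
      zero_mem' := fun φ => by
        have h : ∀ g : H, qinner (0 : H) g = 0 := fun g => by
          simpa using add_qinner (0 : H) 0 g
        simp [h]
      smul_mem' := fun c p hp φ => by
        obtain ⟨q, rfl⟩ := MulOpposite.op_surjective c
        simp only [Prod.smul_fst, Prod.smul_snd, smul_qinner, hp φ] }

/-- The graph of the power series `φ ↦ ∑ₖ Aᵏ φ / k!`, on all vectors `φ` that lie in the domain of
every power of `A` and for which the series converges (`v k` is `Aᵏ φ`). -/
def expSeriesGraph (A : H →ₗ.[ℍᵐᵒᵖ] H) : Submodule ℍᵐᵒᵖ (H × H) where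
  carrier := {p | ∃ v : ℕ → H, v 0 = p.1 ∧ (∀ k, (v k, v (k + 1)) ∈ A.graph) ∧
    HasSum (fun k => v k <• (((k.factorial : ℝ)⁻¹ : ℝ) : ℍ)) p.2}
  add_mem' := by
    rintro p r ⟨v, hv0, hv, hvs⟩ ⟨w, hw0, hw, hws⟩
    refine ⟨v + w, by simp [hv0, hw0], fun k => A.graph.add_mem (hv k) (hw k), ?_⟩
    simpa only [Pi.add_apply, smul_add, Prod.snd_add] using hvs.add hws
  zero_mem' := ⟨0, rfl, fun _ => A.graph.zero_mem, by simp⟩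
  smul_mem' := by
    rintro c p ⟨v, hv0, hv, hvs⟩
    refine ⟨c • v, by simp [hv0], fun k => A.graph.smul_mem c (hv k), ?_⟩
    convert! hvs.const_smul c using 2 with k
    obtain ⟨q, rfl⟩ := MulOpposite.op_surjective c
    rw [Pi.smul_apply, ← mul_smul, ← mul_smul, ← MulOpposite.op_mul, ← MulOpposite.op_mul,
      Quaternion.coe_commutes]

/-- The exponential `e^A` of an (essentially) anti-self-adjoint operator `A` with a dense set of
vectors on which the exponential series converges: the closure of the operator
`φ ↦ ∑ₖ Aᵏ φ / k!`. As that series is isometric where it converges, the closure is the everywhere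
defined unitary operator at time `1` of the one-parameter group generated by `A`. -/
def opExp (A : H →ₗ.[ℍᵐᵒᵖ] H) : H →ₗ.[ℍᵐᵒᵖ] H :=
  (expSeriesGraph A).topologicalClosure.toLinearPMap

/-- The displacement operator `D(x) = exp (x · a† - x̄ · a)`. -/
def displacement [CompleteSpace H] (e : HilbertSeqBasis H) (x : ℍ) : H →ₗ.[ℍᵐᵒᵖ] H :=
  opExp ((leftMul e x).compPMap (creation e) - (leftMul e (star x)).compPMap (annihilation e))

end Quaternionic

end

open scoped Quaternion RightActions

noncomputable section

namespace Quaternionic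

open RightInnerProductSpace Filter Topology

/-! ### Quaternionic inner products: Cauchy–Schwarz, continuity, Cauchy products. -/

section InnerProduct

variable {H : Type*} [NormedAddCommGroup H] [RightInnerProductSpace H]

/-! Put A = x·a† − x̄·a. On finite combinations of basis vectors [a, a†] = 1, and left
multiplications commute with a and a†, so [a, A] is left multiplication by x and [a†, A] is left
multiplication by x̄. Since x and x̄ commute, both multiplications commute with A. Hence a Aᵏ⁺¹ =
Aᵏ⁺¹ a + (k+1) x·Aᵏ, and dividing by (k+1)! and summing gives a e^A f = e^A a f + x·e^A f
(`hasSum_apply_expTerm`); similarly for a†.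

The rest is analysis. The exponential series converges absolutely on finite vectors
(`summable_norm_expTerm`) and is isometric there because A is skew (`qinner_expFinite`). Its
continuous extension `expMap` is unitary, with inverse and adjoint belonging to −x, and D(x) is
exactly this map (`mem_graph_displacement`).

As a and a† are closed with the finite vectors as a core, the identity extends to their full domains
(`expMap_mem_graph`). Applying it for x and for −x gives both inclusions of graphs, hence equality
of domains (`opAdjoint_displacement_comp`). -/

theorem qinner_zero (f : H) : qinner f (0 : H) = 0 := by
  simpa using qinner_add f 0 0

theorem zero_qinner (f : H) : qinner (0 : H) f = 0 := by
  simpa using add_qinner (0 : H) 0 f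

theorem qinner_neg (f g : H) : qinner f (-g) = -qinner f g := by
  rw [eq_neg_iff_add_eq_zero, ← qinner_add, neg_add_cancel, qinner_zero]

theorem neg_qinner (f g : H) : qinner (-f) g = -qinner f g := by
  rw [← star_qinner, qinner_neg, star_neg, star_qinner]

theorem qinner_sub (f g h : H) : qinner f (g - h) = qinner f g - qinner f h := by
  rw [sub_eq_add_neg, qinner_add, qinner_neg, sub_eq_add_neg]

theorem sub_qinner (f g h : H) : qinner (f - g) h = qinner f h - qinner g h := by
  rw [sub_eq_add_neg, add_qinner, neg_qinner, sub_eq_add_neg]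

theorem eq_zero_of_qinner_self {f : H} (h : qinner f f = 0) : f = 0 := by
  rw [qinner_self, ← Quaternion.coe_zero] at h
  simpa using Quaternion.coe_injective h

/-- The Cauchy–Schwarz inequality. -/
theorem norm_qinner_le (f g : H) : ‖qinner f g‖ ≤ ‖f‖ * ‖g‖ := by
  rcases eq_or_ne f 0 with rfl | hf
  · simp [zero_qinner]
  have hf' : 0 < ‖f‖ := norm_pos_iff.mpr hf
  set t : ℍ := qinner f g with ht
  have hgf : qinner g f = star t := by rw [ht, star_qinner]
  -- The vector is −‖f‖² times the component of g orthogonal to f; this scaling avoids division.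
  have key : qinner (f <• t - g <• ((‖f‖ ^ 2 : ℝ) : ℍ)) (f <• t - g <• ((‖f‖ ^ 2 : ℝ) : ℍ)) =
      ((‖f‖ ^ 2 * (‖f‖ ^ 2 * ‖g‖ ^ 2 - ‖t‖ ^ 2) : ℝ) : ℍ) := by
    have hst : star t * t = ((‖t‖ ^ 2 : ℝ) : ℍ) := by
      rw [Quaternion.star_mul_self, Quaternion.normSq_eq_norm_mul_self, sq]
    rw [sub_qinner, qinner_sub, qinner_sub]
    simp only [qinner_smul, smul_qinner, hgf, ← ht, Quaternion.star_coe]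
    rw [qinner_self, qinner_self]
    generalize ‖f‖ ^ 2 = a at *
    generalize ‖g‖ ^ 2 = b at *
    have h1 : star t * (a : ℍ) * t = (a : ℍ) * ((‖t‖ ^ 2 : ℝ) : ℍ) := by
      rw [← Quaternion.coe_commutes, mul_assoc, hst]
    have h2 : (a : ℍ) * star t * t = (a : ℍ) * ((‖t‖ ^ 2 : ℝ) : ℍ) := by
      rw [mul_assoc, hst]
    have h3 : star t * t * (a : ℍ) = (a : ℍ) * ((‖t‖ ^ 2 : ℝ) : ℍ) := by
      rw [hst, ← Quaternion.coe_commutes]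
    rw [h1, h2, h3]
    simp only [← Quaternion.coe_mul, ← Quaternion.coe_sub]
    congr 1
    ring
  rw [qinner_self] at key
  have h := Quaternion.coe_injective key
  have h0 : 0 ≤ ‖f‖ ^ 2 * (‖f‖ ^ 2 * ‖g‖ ^ 2 - ‖t‖ ^ 2) := h ▸ sq_nonneg _
  have h1 := nonneg_of_mul_nonneg_right h0 (by positivity)
  exact le_of_sq_le_sq (by nlinarith) (by positivity)

theorem continuous_qinner_right (f : H) : Continuous fun g : H => qinner f g :=
  AddMonoidHomClass.continuous_of_bound (AddMonoidHom.mk' (fun g : H => qinner f g) (qinner_add f))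
    ‖f‖ fun g => norm_qinner_le f g

theorem continuous_qinner_left (g : H) : Continuous fun f : H => qinner f g := by
  simpa only [Function.comp_def, star_qinner] using
    continuous_star.comp (continuous_qinner_right g)

theorem hasSum_qinner_right (f : H) {ι : Type*} {u : ι → H} {g : H} (h : HasSum u g) :
    HasSum (fun i => qinner f (u i)) (qinner f g) :=
  h.map (AddMonoidHom.mk' (fun g => qinner f g) (qinner_add f)) (continuous_qinner_right f)

theorem hasSum_qinner_left (f : H) {ι : Type*} {u : ι → H} {g : H} (h : HasSum u g) :
    HasSum (fun i => qinner (u i) f) (qinner g f) :=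
  h.map (AddMonoidHom.mk' (fun g => qinner g f) (fun a b => add_qinner a b f))
    (continuous_qinner_left f)

/-- The Cauchy product of two absolutely convergent series. -/
theorem hasSum_qinner_antidiagonal {u w : ℕ → H} {a b : H} (hu : Summable fun n => ‖u n‖)
    (hw : Summable fun n => ‖w n‖) (ha : HasSum u a) (hb : HasSum w b) :
    HasSum (fun n => ∑ p ∈ Finset.HasAntidiagonal.antidiagonal n, qinner (u p.1) (w p.2)) (qinner a b) := by
  have hs : Summable fun p : ℕ × ℕ => qinner (u p.1) (w p.2) :=
    Summable.of_norm_bounded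
      (hu.mul_of_nonneg hw (fun _ => norm_nonneg _) fun _ => norm_nonneg _)
      fun p => norm_qinner_le _ _
  -- The double series converges absolutely, so summing by rows, which gives `qinner a b`, agrees
  -- with summing by antidiagonals.
  have h1 := hs.hasSum.prod_fiberwise fun i => hasSum_qinner_right (u i) hb
  have h2 := h1.unique (hasSum_qinner_left b ha)
  have h3 := hs.hasSum
  rw [h2, ← Finset.HasAntidiagonal.sigmaAntidiagonalEquivProd.hasSum_iff] at h3
  refine h3.sigma fun n => ?_
  have := hasSum_fintype fun p : Finset.HasAntidiagonal.antidiagonal n => qinner (u p.1.1) (w p.1.2)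
  rwa [Finset.univ_eq_attach, Finset.sum_attach (Finset.HasAntidiagonal.antidiagonal n)
    fun p => qinner (u p.1) (w p.2)] at this

end InnerProduct

/-! ### Coordinates in the Hilbert basis and truncation to finite vectors. -/

section Basis

variable {H : Type*} [NormedAddCommGroup H] [RightInnerProductSpace H] (e : HilbertSeqBasis H)

theorem hasSum_ite_eq_apply (n : ℕ) (c : ℕ → ℍ) :
    HasSum (fun k => if n = k then c k else 0) (c n) := by
  simpa using hasSum_single (f := fun k => if n = k then c k else 0) n fun k hk => if_neg hk.symm

theorem qinner_basis_smul (m n : ℕ) (q : ℍ) :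
    qinner (e m) (e n <• q) = if m = n then q else 0 := by
  simp [qinner_smul, e.orthonormal]

/-- Finite right linear combinations of basis vectors. -/
def finiteVectors : Submodule ℍᵐᵒᵖ H := Submodule.span ℍᵐᵒᵖ (Set.range e)

theorem basis_mem_finiteVectors (n : ℕ) : e n ∈ finiteVectors e :=
  Submodule.subset_span ⟨n, rfl⟩

theorem denseRange_finiteVectors : DenseRange (Subtype.val : finiteVectors e → H) :=
  e.dense.denseRange_val

variable {e}

@[elab_as_elim]
theorem finiteVectors_induction {p : H → Prop} (basis : ∀ n, p (e n))
    (add : ∀ f g, p f → p g → p (f + g)) (smul : ∀ (f) (q : ℍ), p f → p (f <• q)) {f : H}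
    (hf : f ∈ finiteVectors e) : p f := by
  refine Submodule.span_induction (p := fun f _ => p f) ?_ ?_ (fun f g _ _ => add f g) ?_ hf
  · rintro _ ⟨n, rfl⟩
    exact basis n
  · simpa using smul _ 0 (basis 0)
  · intro c f _ h
    obtain ⟨q, rfl⟩ := MulOpposite.op_surjective c
    exact smul f q h

/-- The difference is orthogonal to all finite vectors, hence by density to itself. -/
theorem ext_qinner_basis {φ ψ : H} (h : ∀ n, qinner (e n) φ = qinner (e n) ψ) : φ = ψ := by
  have h1 : ∀ f ∈ finiteVectors e, qinner f (φ - ψ) = 0 := fun f hf => by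
    refine finiteVectors_induction (fun n => ?_) (fun f g hf hg => ?_) (fun f q hf => ?_) hf
    · rw [qinner_sub, h, sub_self]
    · rw [add_qinner, hf, hg, add_zero]
    · rw [smul_qinner, hf, mul_zero]
  have h2 : ∀ f : H, qinner f (φ - ψ) = 0 := fun f =>
    (denseRange_finiteVectors e).induction_on (p := fun f => qinner f (φ - ψ) = 0) f
      (isClosed_eq (continuous_qinner_left _) continuous_const) fun f => h1 f f.2
  exact sub_eq_zero.mp (eq_zero_of_qinner_self (h2 _))

theorem ext_qinner_finiteVectors {φ ψ : H}
    (h : ∀ f : finiteVectors e, qinner (f : H) φ = qinner (f : H) ψ) : φ = ψ :=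
  ext_qinner_basis fun n => h ⟨e n, basis_mem_finiteVectors e n⟩

theorem exists_qinner_eq_zero {f : H} (hf : f ∈ finiteVectors e) :
    ∃ N, ∀ n, N ≤ n → qinner (e n) f = 0 := by
  refine finiteVectors_induction (fun k => ⟨k + 1, fun n hn => ?_⟩) ?_ ?_ hf
  · rw [e.orthonormal, if_neg (by omega)]
  · rintro f g ⟨M, hM⟩ ⟨N, hN⟩
    refine ⟨max M N, fun n hn => ?_⟩
    rw [qinner_add, hM n (le_of_max_le_left hn), hN n (le_of_max_le_right hn), add_zero]
  · rintro f q ⟨N, hN⟩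
    exact ⟨N, fun n hn => by rw [qinner_smul, hN n hn, zero_mul]⟩

variable (e)

/-- The orthogonal projection onto the span of the first `N` basis vectors. -/
def truncation (N : ℕ) (φ : H) : finiteVectors e :=
  ⟨∑ k ∈ Finset.range N, e k <• qinner (e k) φ, Submodule.sum_mem _ fun k _ =>
    Submodule.smul_mem _ _ (basis_mem_finiteVectors e k)⟩

theorem qinner_truncation (N : ℕ) (φ : H) (n : ℕ) :
    qinner (e n) (truncation e N φ : H) = if n < N then qinner (e n) φ else 0 := by
  simp [truncation, qinner_sum_right, qinner_basis_smul]

theorem truncation_eq_self {N : ℕ} {φ : H} (h : ∀ n, N ≤ n → qinner (e n) φ = 0) :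
    (truncation e N φ : H) = φ :=
  ext_qinner_basis fun n => by
    rw [qinner_truncation]
    split_ifs with hn
    · rfl
    · rw [h n (not_lt.mp hn)]

theorem norm_sq_truncation (N : ℕ) (φ : H) :
    ‖(truncation e N φ : H)‖ ^ 2 = ∑ k ∈ Finset.range N, ‖qinner (e k) φ‖ ^ 2 :=
  norm_sq_sum e (Finset.range N) fun k => qinner (e k) φ

variable [CompleteSpace H]

theorem qinner_leftMul (q : ℍ) (φ : H) (n : ℕ) :
    qinner (e n) (leftMul e q φ) = q * qinner (e n) φ := by
  have h := hasSum_qinner_right (e n) (summable_ketBra e q φ).hasSum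
  refine h.unique ?_
  simp only [ketBra, LinearMap.coe_mk, AddHom.coe_mk, qinner_basis_smul]
  exact hasSum_ite_eq_apply n fun k => q * qinner (e k) φ

/-- Left multiplication by 1 has the coordinates of the identity, and its defining series is already
known to converge. -/
theorem hasSum_basis (φ : H) : HasSum (fun k => e k <• qinner (e k) φ) φ := by
  have h1 : leftMul e 1 φ = φ := ext_qinner_basis fun n => by rw [qinner_leftMul, one_mul]
  have h := (summable_ketBra e 1 φ).hasSum
  change HasSum _ (leftMul e 1 φ) at h
  rw [h1] at h
  simpa [ketBra] using h

theorem tendsto_truncation (φ : H) :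
    Tendsto (fun N => (truncation e N φ : H)) atTop (𝓝 φ) :=
  (hasSum_basis e φ).tendsto_sum_nat

end Basis

/-! ### Graphs of unbounded operators; the ladder operators as weighted shifts. -/

section Graph

variable {H : Type*} [NormedAddCommGroup H] [RightInnerProductSpace H]

/-- Operators are compared through their graphs, so that equality of domains comes along with
equality of values. -/
theorem mem_graph_seriesOp {T : ℕ → H →ₗ[ℍᵐᵒᵖ] H} {φ η : H} :
    (φ, η) ∈ (seriesOp T).graph ↔ HasSum (fun k => T k φ) η := by
  rw [LinearPMap.mem_graph_iff]
  constructor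
  · rintro ⟨⟨y, hy⟩, rfl, rfl⟩
    exact Summable.hasSum hy
  · intro h
    exact ⟨⟨φ, h.summable⟩, rfl, h.tsum_eq⟩

theorem mem_graph_opComp {S T : H →ₗ.[ℍᵐᵒᵖ] H} {φ η : H} :
    (φ, η) ∈ (opComp S T).graph ↔ ∃ ψ, (φ, ψ) ∈ T.graph ∧ (ψ, η) ∈ S.graph := by
  simp only [LinearPMap.mem_graph_iff]
  constructor
  · rintro ⟨⟨y, ⟨⟨ψ, hψ, rfl⟩, hy⟩⟩, rfl, rfl⟩
    exact ⟨T ψ, ⟨ψ, rfl, rfl⟩, ⟨⟨T ψ, hψ⟩, rfl, rfl⟩⟩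
  · rintro ⟨ψ, ⟨y, rfl, rfl⟩, ⟨z, hz, rfl⟩⟩
    have hy : T y ∈ S.domain := hz ▸ z.2
    refine ⟨⟨y, ⟨⟨y, hy, rfl⟩, y.2⟩⟩, rfl, ?_⟩
    have : z = ⟨T y, hy⟩ := Subtype.ext hz
    rw [this]
    rfl

theorem mem_graph_add {S T : H →ₗ.[ℍᵐᵒᵖ] H} {φ η : H} :
    (φ, η) ∈ (S + T).graph ↔ ∃ α β, (φ, α) ∈ S.graph ∧ (φ, β) ∈ T.graph ∧ α + β = η := by
  simp only [LinearPMap.mem_graph_iff]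
  constructor
  · rintro ⟨⟨_, hS, hT⟩, rfl, rfl⟩
    exact ⟨_, _, ⟨⟨_, hS⟩, rfl, rfl⟩, ⟨⟨_, hT⟩, rfl, rfl⟩, rfl⟩
  · rintro ⟨_, _, ⟨⟨y, hS⟩, rfl, rfl⟩, ⟨⟨z, hT⟩, hz, rfl⟩, rfl⟩
    obtain rfl : z = y := hz
    exact ⟨⟨z, hS, hT⟩, rfl, rfl⟩

theorem mem_graph_sub {S T : H →ₗ.[ℍᵐᵒᵖ] H} {φ η : H} :
    (φ, η) ∈ (S - T).graph ↔ ∃ α β, (φ, α) ∈ S.graph ∧ (φ, β) ∈ T.graph ∧ α - β = η := by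
  simp only [LinearPMap.mem_graph_iff]
  constructor
  · rintro ⟨⟨_, hS, hT⟩, rfl, rfl⟩
    exact ⟨_, _, ⟨⟨_, hS⟩, rfl, rfl⟩, ⟨⟨_, hT⟩, rfl, rfl⟩, rfl⟩
  · rintro ⟨_, _, ⟨⟨y, hS⟩, rfl, rfl⟩, ⟨⟨z, hT⟩, hz, rfl⟩, rfl⟩
    obtain rfl : z = y := hz
    exact ⟨⟨z, hS, hT⟩, rfl, rfl⟩

theorem mem_graph_compPMap {L : H →ₗ[ℍᵐᵒᵖ] H} {T : H →ₗ.[ℍᵐᵒᵖ] H} {φ η : H} :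
    (φ, η) ∈ (L.compPMap T).graph ↔ ∃ α, (φ, α) ∈ T.graph ∧ L α = η := by
  simp only [LinearPMap.mem_graph_iff]
  constructor
  · rintro ⟨y, rfl, rfl⟩
    exact ⟨_, ⟨y, rfl, rfl⟩, rfl⟩
  · rintro ⟨_, ⟨y, rfl, rfl⟩, rfl⟩
    exact ⟨y, rfl, rfl⟩

theorem mem_graph_toPMap_top {L : H →ₗ[ℍᵐᵒᵖ] H} {φ η : H} :
    (φ, η) ∈ (L.toPMap ⊤).graph ↔ L φ = η := by
  simp [LinearPMap.mem_graph_iff]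

variable (e : HilbertSeqBasis H)

/-- `T` is the maximal operator acting on coefficients by the weighted shift
`c ↦ fun n => w n * c (σ n)`. -/
def IsWeightedShift (T : H →ₗ.[ℍᵐᵒᵖ] H) (w : ℕ → ℝ) (σ : ℕ → ℕ) : Prop :=
  ∀ φ η, (φ, η) ∈ T.graph ↔ ∀ n, qinner (e n) η = (w n : ℍ) * qinner (e (σ n)) φ

theorem IsWeightedShift.isClosed_graph {e : HilbertSeqBasis H} {T : H →ₗ.[ℍᵐᵒᵖ] H} {w : ℕ → ℝ}
    {σ : ℕ → ℕ} (hT : IsWeightedShift e T w σ) : IsClosed (T.graph : Set (H × H)) := by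
  have : (T.graph : Set (H × H)) =
      ⋂ n, {p | qinner (e n) p.2 = (w n : ℍ) * qinner (e (σ n)) p.1} := by
    ext ⟨φ, η⟩
    simpa using hT φ η
  rw [this]
  exact isClosed_iInter fun n => isClosed_eq ((continuous_qinner_right _).comp continuous_snd)
    (continuous_const.mul ((continuous_qinner_right _).comp continuous_fst))

variable [CompleteSpace H]

/-- When the coordinates match, the defining series is the basis expansion of η, so its convergence
is automatic. -/
theorem isWeightedShift_annihilation :
    IsWeightedShift e (annihilation e) (fun n => √(n + 1)) (fun n => n + 1) := by
  intro φ η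
  rw [annihilation, mem_graph_seriesOp]
  simp only [ketBra, LinearMap.coe_mk, AddHom.coe_mk]
  constructor
  · intro h n
    refine (hasSum_qinner_right (e n) h).unique ?_
    simp only [qinner_basis_smul]
    exact hasSum_ite_eq_apply n fun k => ((√(k + 1) : ℝ) : ℍ) * qinner (e (k + 1)) φ
  · intro h
    simp only [← h]
    exact hasSum_basis e η

/-- At n = 0 the truncated `n - 1` is harmless, as the weight √0 vanishes. For the converse, the
coordinate of η at 0 is zero, so its expansion may start at index 1. -/
theorem isWeightedShift_creation :
    IsWeightedShift e (creation e) (fun n => √n) (fun n => n - 1) := by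
  intro φ η
  rw [creation, mem_graph_seriesOp]
  simp only [ketBra, LinearMap.coe_mk, AddHom.coe_mk]
  constructor
  · intro h n
    have h1 := hasSum_qinner_right (e n) h
    simp only [qinner_basis_smul] at h1
    refine h1.unique ?_
    rcases n with _ | n
    · simp
    · simp only [Nat.add_right_cancel_iff, Nat.cast_add, Nat.cast_one, Nat.add_sub_cancel]
      exact hasSum_ite_eq_apply n fun k => ((√(k + 1) : ℝ) : ℍ) * qinner (e k) φ
  · intro h
    have h0 : qinner (e 0) η = 0 := by simp [h 0]
    have h1 := hasSum_basis e η
    rw [← hasSum_nat_add_iff' 1] at h1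
    simpa [h, h0] using h1

end Graph

/-! ### A commutator identity for powers. -/

section Ring

variable {R : Type*} [Semiring R]

/-- Moving T past each factor A leaves one L; since L commutes with A, the k + 1 leftover terms
coincide. -/
theorem mul_pow_of_mul_eq_add {T A L : R} (h : T * A = A * T + L)
    (hL : L * A = A * L) (k : ℕ) :
    T * A ^ (k + 1) = A ^ (k + 1) * T + (k + 1) • (L * A ^ k) := by
  induction k with
  | zero => simp [h]
  | succ k ih =>
    have hk : L * A ^ (k + 1) = A ^ (k + 1) * L := (Commute.pow_right hL (k + 1) :)
    rw [pow_succ A (k + 1), ← mul_assoc, ih, add_mul, mul_assoc, h, mul_add, smul_mul_assoc,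
      mul_assoc L, ← pow_succ, ← hk, ← mul_assoc, add_assoc, ← succ_nsmul']

end Ring

/-! ### Algebra of the ladder operators on finite vectors. -/

section Core

variable {H : Type*} [NormedAddCommGroup H] [RightInnerProductSpace H] {e : HilbertSeqBasis H}

theorem finiteVectors_induction_subtype {p : finiteVectors e → Prop}
    (basis : ∀ n, p ⟨e n, basis_mem_finiteVectors e n⟩)
    (add : ∀ f g, p f → p g → p (f + g)) (smul : ∀ (f) (q : ℍ), p f → p (f <• q))
    (f : finiteVectors e) : p f := by
  obtain ⟨f, hf⟩ := f
  refine Submodule.span_induction (p := fun f hf => p ⟨f, hf⟩) ?_ ?_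
    (fun f g hf hg => add ⟨f, hf⟩ ⟨g, hg⟩) ?_ hf
  · rintro _ ⟨n, rfl⟩
    exact basis n
  · have h := smul _ 0 (basis 0)
    rwa [MulOpposite.op_zero, zero_smul] at h
  · intro c f hf h
    obtain ⟨q, rfl⟩ := MulOpposite.op_surjective c
    exact smul ⟨f, hf⟩ q h

theorem exists_mem_graph_of_basis {T : H →ₗ.[ℍᵐᵒᵖ] H}
    (h : ∀ n, ∃ g ∈ finiteVectors e, (e n, g) ∈ T.graph) (f : finiteVectors e) :
    ∃ g : finiteVectors e, ((f : H), (g : H)) ∈ T.graph := by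
  refine finiteVectors_induction_subtype
    (p := fun f => ∃ g : finiteVectors e, ((f : H), (g : H)) ∈ T.graph) (fun n => ?_) ?_ ?_ f
  · obtain ⟨g, hg, h⟩ := h n
    exact ⟨⟨g, hg⟩, h⟩
  · rintro f₁ f₂ ⟨g₁, h₁⟩ ⟨g₂, h₂⟩
    exact ⟨g₁ + g₂, T.graph.add_mem h₁ h₂⟩
  · rintro f q ⟨g, h⟩
    exact ⟨g <• q, T.graph.smul_mem _ h⟩

variable (e) in
/-- The restriction to finite vectors of an operator that maps basis vectors to finite vectors. -/
def restrictFinite (T : H →ₗ.[ℍᵐᵒᵖ] H) (h : ∀ n, ∃ g ∈ finiteVectors e, (e n, g) ∈ T.graph) :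
    Module.End ℍᵐᵒᵖ (finiteVectors e) where
  toFun f := (exists_mem_graph_of_basis h f).choose
  -- The values are chosen, but the graph is single-valued and a submodule, which forces linearity.
  map_add' f g := Subtype.ext <| T.mem_graph_snd_inj (exists_mem_graph_of_basis h (f + g)).choose_spec
    (T.graph.add_mem (exists_mem_graph_of_basis h f).choose_spec
      (exists_mem_graph_of_basis h g).choose_spec) rfl
  map_smul' c f := Subtype.ext <| T.mem_graph_snd_inj
    (exists_mem_graph_of_basis h (c • f)).choose_spec
    (T.graph.smul_mem c (exists_mem_graph_of_basis h f).choose_spec) rfl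

theorem restrictFinite_mem_graph {T : H →ₗ.[ℍᵐᵒᵖ] H}
    (h : ∀ n, ∃ g ∈ finiteVectors e, (e n, g) ∈ T.graph) (f : finiteVectors e) :
    ((f : H), (restrictFinite e T h f : H)) ∈ T.graph :=
  (exists_mem_graph_of_basis h f).choose_spec

theorem basis_smul_mem_finiteVectors (n : ℕ) (q : ℍ) : e n <• q ∈ finiteVectors e :=
  Submodule.smul_mem _ _ (basis_mem_finiteVectors e n)

theorem finiteVectors_ext {f g : finiteVectors e}
    (h : ∀ n, qinner (e n) (f : H) = qinner (e n) (g : H)) : f = g :=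
  Subtype.ext (ext_qinner_basis h)

variable [CompleteSpace H]

theorem basis_mem_graph_annihilation (n : ℕ) :
    (e n, e (n - 1) <• ((√n : ℝ) : ℍ)) ∈ (annihilation e).graph := by
  rw [isWeightedShift_annihilation e]
  intro m
  rw [qinner_basis_smul, e.orthonormal]
  rcases n with _ | n
  · simp
  · simp only [Nat.add_sub_cancel, Nat.add_right_cancel_iff]
    split_ifs with h <;> simp [h]

theorem basis_mem_graph_creation (n : ℕ) :
    (e n, e (n + 1) <• ((√(n + 1) : ℝ) : ℍ)) ∈ (creation e).graph := by
  rw [isWeightedShift_creation e]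
  intro m
  rw [qinner_basis_smul, e.orthonormal]
  rcases m with _ | m
  · simp
  · simp only [Nat.add_sub_cancel, Nat.add_right_cancel_iff]
    split_ifs with h <;> simp [h]

theorem leftMul_basis (n : ℕ) (p q : ℍ) : leftMul e q (e n <• p) = e n <• (q * p) :=
  ext_qinner_basis fun m => by
    rw [qinner_leftMul, qinner_basis_smul, qinner_basis_smul, mul_ite, mul_zero]

theorem leftMul_smul (f : H) (p q : ℍ) : leftMul e q (f <• p) = leftMul e q f <• p :=
  map_smul _ _ _

variable (e)

/-- The annihilation operator on finite vectors. -/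
def annFinite : Module.End ℍᵐᵒᵖ (finiteVectors e) :=
  restrictFinite e (annihilation e) fun n =>
    ⟨_, basis_smul_mem_finiteVectors _ _, basis_mem_graph_annihilation n⟩

/-- The creation operator on finite vectors. -/
def creFinite : Module.End ℍᵐᵒᵖ (finiteVectors e) :=
  restrictFinite e (creation e) fun n =>
    ⟨_, basis_smul_mem_finiteVectors _ _, basis_mem_graph_creation n⟩

/-- Left multiplication on finite vectors. -/
def mulFinite (q : ℍ) : Module.End ℍᵐᵒᵖ (finiteVectors e) :=
  restrictFinite e ((leftMul e q).toPMap ⊤) fun n =>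
    ⟨e n <• q, basis_smul_mem_finiteVectors _ _, mem_graph_toPMap_top.2 <| by
      simpa using leftMul_basis (e := e) n 1 q⟩

variable {e}

theorem annFinite_mem_graph (f : finiteVectors e) :
    ((f : H), (annFinite e f : H)) ∈ (annihilation e).graph :=
  restrictFinite_mem_graph _ f

theorem creFinite_mem_graph (f : finiteVectors e) :
    ((f : H), (creFinite e f : H)) ∈ (creation e).graph :=
  restrictFinite_mem_graph _ f

theorem coe_mulFinite (q : ℍ) (f : finiteVectors e) :
    (mulFinite e q f : H) = leftMul e q (f : H) :=
  (mem_graph_toPMap_top.1 (restrictFinite_mem_graph _ f)).symm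

theorem annFinite_basis (n : ℕ) :
    (annFinite e ⟨e n, basis_mem_finiteVectors e n⟩ : H) = e (n - 1) <• ((√n : ℝ) : ℍ) :=
  (annihilation e).mem_graph_snd_inj (annFinite_mem_graph _) (basis_mem_graph_annihilation n) rfl

theorem creFinite_basis (n : ℕ) :
    (creFinite e ⟨e n, basis_mem_finiteVectors e n⟩ : H) = e (n + 1) <• ((√(n + 1) : ℝ) : ℍ) :=
  (creation e).mem_graph_snd_inj (creFinite_mem_graph _) (basis_mem_graph_creation n) rfl

theorem qinner_annFinite (f : finiteVectors e) (n : ℕ) :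
    qinner (e n) (annFinite e f : H) = ((√(n + 1) : ℝ) : ℍ) * qinner (e (n + 1)) (f : H) :=
  (isWeightedShift_annihilation e _ _).1 (annFinite_mem_graph f) n

theorem qinner_creFinite (f : finiteVectors e) (n : ℕ) :
    qinner (e n) (creFinite e f : H) = ((√n : ℝ) : ℍ) * qinner (e (n - 1)) (f : H) :=
  (isWeightedShift_creation e _ _).1 (creFinite_mem_graph f) n

theorem qinner_mulFinite (q : ℍ) (f : finiteVectors e) (n : ℕ) :
    qinner (e n) (mulFinite e q f : H) = q * qinner (e n) (f : H) := by
  rw [coe_mulFinite, qinner_leftMul]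

theorem coe_real_mul_left_comm (r : ℝ) (p q : ℍ) : (r : ℍ) * (p * q) = p * ((r : ℍ) * q) := by
  rw [← mul_assoc, Quaternion.coe_commutes, mul_assoc]

theorem annFinite_mul_mulFinite (q : ℍ) :
    annFinite e * mulFinite e q = mulFinite e q * annFinite e :=
  LinearMap.ext fun f => finiteVectors_ext fun n => by
    simp only [Module.End.mul_apply, qinner_annFinite, qinner_mulFinite, coe_real_mul_left_comm]

theorem creFinite_mul_mulFinite (q : ℍ) :
    creFinite e * mulFinite e q = mulFinite e q * creFinite e :=
  LinearMap.ext fun f => finiteVectors_ext fun n => by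
    simp only [Module.End.mul_apply, qinner_creFinite, qinner_mulFinite, coe_real_mul_left_comm]

/-- The canonical commutation relation. -/
theorem annFinite_mul_creFinite :
    annFinite e * creFinite e = creFinite e * annFinite e + 1 :=
  LinearMap.ext fun f => finiteVectors_ext fun n => by
    simp only [Module.End.mul_apply, LinearMap.add_apply, Module.End.one_apply,
      Submodule.coe_add, qinner_add, qinner_annFinite, qinner_creFinite]
    rcases n with _ | n
    · simp
    -- On the coordinate of index n + 1 the relation reads (n + 2) c = (n + 1) c + c.
    · have h : ∀ m : ℕ, ((√(m + 1 : ℝ) : ℝ) : ℍ) * ((√(m + 1 : ℝ) : ℝ) : ℍ) = ((m : ℝ) : ℍ) + 1 := by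
        intro m
        rw [← Quaternion.coe_mul, Real.mul_self_sqrt (by positivity)]
        simp
      have h1 := h n
      have h2 := h (n + 1)
      push_cast at h1 h2 ⊢
      simp only [← mul_assoc, h1, h2, add_mul, one_mul]

variable (e)

/-- The operator `x · a† - x̄ · a` on finite vectors. -/
def generatorFinite (x : ℍ) : Module.End ℍᵐᵒᵖ (finiteVectors e) :=
  mulFinite e x * creFinite e - mulFinite e (star x) * annFinite e

/-- The operator `x · a† - x̄ · a`. -/
def generator (x : ℍ) : H →ₗ.[ℍᵐᵒᵖ] H :=
  (leftMul e x).compPMap (creation e) - (leftMul e (star x)).compPMap (annihilation e)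

variable {e}

theorem generatorFinite_mem_graph (x : ℍ) (f : finiteVectors e) :
    ((f : H), (generatorFinite e x f : H)) ∈ (generator e x).graph :=
  mem_graph_sub.2 ⟨_, _, mem_graph_compPMap.2 ⟨_, creFinite_mem_graph f, rfl⟩,
    mem_graph_compPMap.2 ⟨_, annFinite_mem_graph f, rfl⟩, by
      simp [generatorFinite, coe_mulFinite]⟩

theorem qinner_of_mem_graph_generator {x : ℍ} {φ η : H} (h : (φ, η) ∈ (generator e x).graph)
    (n : ℕ) : qinner (e n) η = x * (((√n : ℝ) : ℍ) * qinner (e (n - 1)) φ) -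
      star x * (((√(n + 1) : ℝ) : ℍ) * qinner (e (n + 1)) φ) := by
  obtain ⟨_, _, h₁, h₂, rfl⟩ := mem_graph_sub.1 h
  obtain ⟨α, hα, rfl⟩ := mem_graph_compPMap.1 h₁
  obtain ⟨β, hβ, rfl⟩ := mem_graph_compPMap.1 h₂
  rw [qinner_sub, qinner_leftMul, qinner_leftMul, (isWeightedShift_creation e _ _).1 hα,
    (isWeightedShift_annihilation e _ _).1 hβ]

theorem generatorFinite_basis (x : ℍ) (n : ℕ) :
    (generatorFinite e x ⟨e n, basis_mem_finiteVectors e n⟩ : H) =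
      e (n + 1) <• (x * ((√(n + 1) : ℝ) : ℍ)) - e (n - 1) <• (star x * ((√n : ℝ) : ℍ)) := by
  simp only [generatorFinite, LinearMap.sub_apply, Module.End.mul_apply, Submodule.coe_sub,
    coe_mulFinite, creFinite_basis, annFinite_basis, leftMul_basis]

/-- The generator is skew-adjoint. -/
theorem qinner_generator {x : ℍ} {φ η : H} (h : (φ, η) ∈ (generator e x).graph)
    (f : finiteVectors e) : qinner (f : H) η = -qinner (generatorFinite e x f : H) φ := by
  refine finiteVectors_induction_subtype
    (p := fun f => qinner (f : H) η = -qinner (generatorFinite e x f : H) φ)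
    (fun n => ?_) (fun f g hf hg => ?_) (fun f q hf => ?_) f
  · rw [qinner_of_mem_graph_generator h, generatorFinite_basis, sub_qinner, smul_qinner,
      smul_qinner, star_mul, star_mul, Quaternion.star_coe, Quaternion.star_coe, star_star,
      mul_assoc, mul_assoc, coe_real_mul_left_comm, coe_real_mul_left_comm, neg_sub]
  · rw [map_add, Submodule.coe_add, Submodule.coe_add, add_qinner, add_qinner, hf, hg, neg_add]
  · rw [map_smul, Submodule.coe_smul, Submodule.coe_smul, smul_qinner, smul_qinner, hf, mul_neg]

/-- The real weights are central, so only the coefficients x and x̄ of the generator have to commute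
with q. This covers q = x and q = x̄, but not a general quaternion. -/
theorem mulFinite_mul_generatorFinite {x q : ℍ} (h : q * x = x * q)
    (h' : q * star x = star x * q) :
    mulFinite e q * generatorFinite e x = generatorFinite e x * mulFinite e q :=
  LinearMap.ext fun f => finiteVectors_ext fun n => by
    simp only [generatorFinite, LinearMap.sub_apply, Module.End.mul_apply, Submodule.coe_sub,
      qinner_sub, qinner_mulFinite, qinner_annFinite, qinner_creFinite, mul_sub,
      coe_real_mul_left_comm]
    simp only [← mul_assoc, h, h']

/-- The term x̄·a commutes with a, and x·a† contributes x·[a, a†]. -/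
theorem annFinite_mul_generatorFinite (x : ℍ) :
    annFinite e * generatorFinite e x = generatorFinite e x * annFinite e + mulFinite e x :=
  LinearMap.ext fun f => by
    have h := LinearMap.congr_fun (annFinite_mul_creFinite (e := e)) f
    have hm := fun q g => LinearMap.congr_fun (annFinite_mul_mulFinite (e := e) q) g
    simp only [Module.End.mul_apply, LinearMap.add_apply, Module.End.one_apply] at h hm
    simp only [generatorFinite, Module.End.mul_apply, LinearMap.sub_apply, LinearMap.add_apply,
      map_sub, hm, h, map_add]
    abel

theorem creFinite_mul_generatorFinite (x : ℍ) :
    creFinite e * generatorFinite e x =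
      generatorFinite e x * creFinite e + mulFinite e (star x) :=
  LinearMap.ext fun f => by
    have h := LinearMap.congr_fun (annFinite_mul_creFinite (e := e)) f
    have hm := fun q g => LinearMap.congr_fun (creFinite_mul_mulFinite (e := e) q) g
    simp only [Module.End.mul_apply, LinearMap.add_apply, Module.End.one_apply] at h hm
    simp only [generatorFinite, Module.End.mul_apply, LinearMap.sub_apply, LinearMap.add_apply,
      map_sub, hm, h, map_add]
    abel

theorem generatorFinite_neg (x : ℍ) : generatorFinite e (-x) = -generatorFinite e x := by
  refine LinearMap.ext fun f => finiteVectors_ext fun n => ?_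
  simp only [generatorFinite, LinearMap.sub_apply, LinearMap.neg_apply, Module.End.mul_apply,
    Submodule.coe_sub, Submodule.coe_neg, qinner_sub, qinner_neg, qinner_mulFinite, star_neg,
    neg_mul]
  abel

end Core

/-! ### Growth of norms and supports under the generator. -/

section Bounds

variable {H : Type*} [NormedAddCommGroup H] [RightInnerProductSpace H] {e : HilbertSeqBasis H}

theorem norm_sq_eq_sum {N : ℕ} {f : H} (h : ∀ n, N ≤ n → qinner (e n) f = 0) :
    ‖f‖ ^ 2 = ∑ k ∈ Finset.range N, ‖qinner (e k) f‖ ^ 2 := by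
  rw [← norm_sq_truncation, truncation_eq_self e h]

variable [CompleteSpace H]

theorem norm_leftMul_le (q : ℍ) (φ : H) : ‖leftMul e q φ‖ ≤ ‖q‖ * ‖φ‖ := by
  refine le_of_tendsto (tendsto_truncation e (leftMul e q φ)).norm (Eventually.of_forall fun N => ?_)
  refine le_of_sq_le_sq ?_ (by positivity)
  rw [norm_sq_truncation]
  simp only [qinner_leftMul, norm_mul, mul_pow]
  rw [← Finset.mul_sum]
  gcongr
  exact bessel e _ φ

/-- On vectors supported below level N every weight that occurs is at most √N. -/
theorem norm_annFinite_le {N : ℕ} {f : finiteVectors e}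
    (h : ∀ n, N ≤ n → qinner (e n) (f : H) = 0) : ‖(annFinite e f : H)‖ ≤ √N * ‖(f : H)‖ := by
  refine le_of_sq_le_sq ?_ (by positivity)
  rw [norm_sq_eq_sum (e := e) (N := N) fun n hn => by
    rw [qinner_annFinite, h _ (hn.trans n.le_succ), mul_zero], mul_pow, Real.sq_sqrt N.cast_nonneg]
  calc ∑ k ∈ Finset.range N, ‖qinner (e k) (annFinite e f : H)‖ ^ 2
      ≤ ∑ k ∈ Finset.range N, N * ‖qinner (e (k + 1)) (f : H)‖ ^ 2 := by
        refine Finset.sum_le_sum fun k hk => ?_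
        rw [qinner_annFinite, norm_mul, mul_pow, Quaternion.norm_coe, Real.norm_eq_abs, sq_abs,
          Real.sq_sqrt (by positivity)]
        gcongr
        exact_mod_cast Finset.mem_range.1 hk
    _ ≤ N * ∑ k ∈ Finset.range (N + 1), ‖qinner (e k) (f : H)‖ ^ 2 := by
        rw [Finset.sum_range_succ', ← Finset.mul_sum]
        gcongr
        exact le_add_of_nonneg_right (by positivity)
    _ ≤ N * ‖(f : H)‖ ^ 2 := by
        gcongr
        exact bessel e _ _

theorem norm_creFinite_le {N : ℕ} {f : finiteVectors e}
    (h : ∀ n, N ≤ n → qinner (e n) (f : H) = 0) : ‖(creFinite e f : H)‖ ≤ √N * ‖(f : H)‖ := by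
  refine le_of_sq_le_sq ?_ (by positivity)
  rw [norm_sq_eq_sum (e := e) (N := N + 1) fun n hn => by
    rw [qinner_creFinite, h _ (by omega), mul_zero], mul_pow, Real.sq_sqrt N.cast_nonneg,
    Finset.sum_range_succ', norm_sq_eq_sum h, Finset.mul_sum]
  simp only [qinner_creFinite, norm_mul, mul_pow, Quaternion.norm_coe, Real.norm_eq_abs, sq_abs,
    Nat.cast_zero, Real.sqrt_zero]
  rw [zero_pow two_ne_zero, zero_mul, add_zero]
  refine Finset.sum_le_sum fun k hk => ?_
  rw [Real.sq_sqrt (by positivity), Nat.add_sub_cancel]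
  gcongr
  exact_mod_cast Finset.mem_range.1 hk

theorem norm_generatorFinite_le (x : ℍ) {N : ℕ} {f : finiteVectors e}
    (h : ∀ n, N ≤ n → qinner (e n) (f : H) = 0) :
    ‖(generatorFinite e x f : H)‖ ≤ 2 * ‖x‖ * √N * ‖(f : H)‖ := by
  have h1 := (norm_leftMul_le (e := e) x (creFinite e f : H)).trans
    (mul_le_mul_of_nonneg_left (norm_creFinite_le h) (norm_nonneg _))
  have h2 := (norm_leftMul_le (e := e) (star x) (annFinite e f : H)).trans
    (mul_le_mul_of_nonneg_left (norm_annFinite_le h) (norm_nonneg _))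
  rw [norm_star] at h2
  simp only [generatorFinite, LinearMap.sub_apply, Module.End.mul_apply, Submodule.coe_sub,
    coe_mulFinite]
  refine (norm_sub_le _ _).trans ?_
  linarith

theorem qinner_generatorFinite_pow_eq_zero (x : ℍ) {N : ℕ} {f : finiteVectors e}
    (h : ∀ n, N ≤ n → qinner (e n) (f : H) = 0) (k : ℕ) :
    ∀ n, N + k ≤ n → qinner (e n) ((generatorFinite e x ^ k) f : H) = 0 := by
  induction k with
  | zero => simpa using h
  | succ k ih =>
    intro n hn
    rw [pow_succ', Module.End.mul_apply,
      qinner_of_mem_graph_generator (generatorFinite_mem_graph x _), ih _ (by omega),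
      ih _ (by omega)]
    simp

end Bounds

/-! ### The exponential series on finite vectors. -/

section Exponential

variable {H : Type*} [NormedAddCommGroup H] [RightInnerProductSpace H] [CompleteSpace H]
  (e : HilbertSeqBasis H)

/-- The terms `Aᵏ f / k!` of the exponential series of the generator on a finite vector. -/
def expTerm (x : ℍ) (f : finiteVectors e) (k : ℕ) : H :=
  ((generatorFinite e x ^ k) f : H) <• (((k.factorial : ℝ)⁻¹ : ℝ) : ℍ)

variable {e}

theorem norm_expTerm (x : ℍ) (f : finiteVectors e) (k : ℕ) :
    ‖expTerm e x f k‖ = ‖((generatorFinite e x ^ k) f : H)‖ * (k.factorial : ℝ)⁻¹ := by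
  rw [expTerm, norm_rsmul, Quaternion.norm_coe, Real.norm_of_nonneg (by positivity)]

/-- Aᵏ f is supported below level N + k, so one more application of A costs only √(N + k), which the
factor k + 1 from the factorial beats. -/
theorem norm_expTerm_succ_le (x : ℍ) {N : ℕ} {f : finiteVectors e}
    (h : ∀ n, N ≤ n → qinner (e n) (f : H) = 0) (k : ℕ) :
    ‖expTerm e x f (k + 1)‖ ≤ 2 * ‖x‖ * √(N + k) / (k + 1) * ‖expTerm e x f k‖ := by
  have h1 := norm_generatorFinite_le x (qinner_generatorFinite_pow_eq_zero x h k)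
  rw [norm_expTerm, norm_expTerm, pow_succ', Module.End.mul_apply, Nat.factorial_succ]
  push_cast at h1 ⊢
  rw [mul_inv, div_eq_mul_inv]
  calc _ ≤ (2 * ‖x‖ * √(N + k) * ‖((generatorFinite e x ^ k) f : H)‖) *
        (((k : ℝ) + 1)⁻¹ * (k.factorial : ℝ)⁻¹) := by gcongr
    _ = _ := by ring

theorem summable_norm_expTerm (x : ℍ) (f : finiteVectors e) :
    Summable fun k => ‖expTerm e x f k‖ := by
  obtain ⟨N, hN⟩ := exists_qinner_eq_zero f.2
  refine summable_of_ratio_norm_eventually_le (r := 1 / 2) (by norm_num) ?_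
  -- For k ≥ N and k ≥ 32‖x‖², the squared numerator 4‖x‖²(N + k) is at most 8‖x‖²k ≤ k²/4, so the
  -- ratio is at most 1/2.
  obtain ⟨M, hM⟩ := exists_nat_ge (32 * ‖x‖ ^ 2)
  filter_upwards [eventually_ge_atTop (max N M)] with k hk
  rw [norm_norm, norm_norm]
  refine (norm_expTerm_succ_le x hN k).trans (mul_le_mul_of_nonneg_right ?_ (norm_nonneg _))
  have hNk : (N : ℝ) ≤ k := by exact_mod_cast le_of_max_le_left hk
  have hMk : (M : ℝ) ≤ k := by exact_mod_cast le_of_max_le_right hk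
  rw [div_le_iff₀ (by positivity)]
  refine le_of_sq_le_sq ?_ (by positivity)
  rw [mul_pow, Real.sq_sqrt (by positivity)]
  have : ‖x‖ ^ 2 * (N + k) ≤ ‖x‖ ^ 2 * (2 * k) := by gcongr; linarith
  have : 32 * ‖x‖ ^ 2 * k ≤ k * k := by gcongr; linarith
  nlinarith

variable (e) in
/-- The exponential series of the generator on finite vectors. -/
def expFinite (x : ℍ) : finiteVectors e →+ H where
  toFun f := ∑' k, expTerm e x f k
  map_zero' := by simp [expTerm]
  map_add' f g := by
    rw [← (summable_norm_expTerm x f).of_norm.tsum_add (summable_norm_expTerm x g).of_norm]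
    simp only [expTerm, map_add, Submodule.coe_add, smul_add]

theorem hasSum_expFinite (x : ℍ) (f : finiteVectors e) :
    HasSum (expTerm e x f) (expFinite e x f) :=
  (summable_norm_expTerm x f).of_norm.hasSum

theorem expFinite_mem_expSeriesGraph (x : ℍ) (f : finiteVectors e) :
    ((f : H), expFinite e x f) ∈ expSeriesGraph (generator e x) := by
  refine ⟨fun k => ((generatorFinite e x ^ k) f : H), by simp, fun k => ?_, hasSum_expFinite x f⟩
  simp only [pow_succ', Module.End.mul_apply]
  exact generatorFinite_mem_graph x _

theorem qinner_generatorFinite_pow {x : ℍ} {v : ℕ → H}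
    (h : ∀ k, (v k, v (k + 1)) ∈ (generator e x).graph) (k m : ℕ) (f : finiteVectors e) :
    qinner (f : H) (v (m + k)) = (-1) ^ k * qinner ((generatorFinite e x ^ k) f : H) (v m) := by
  induction k generalizing f with
  | zero => simp
  | succ k ih =>
    rw [← add_assoc, qinner_generator (h (m + k)), ih, pow_succ, pow_succ, Module.End.mul_apply]
    simp

theorem generatorFinite_neg_pow (x : ℍ) (k : ℕ) (f : finiteVectors e) :
    ((generatorFinite e (-x) ^ k) f : H) = ((generatorFinite e x ^ k) f : H) <• ((-1 : ℍ) ^ k) := by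
  induction k with
  | zero => simp
  | succ k ih =>
    rw [pow_succ' (generatorFinite e (-x)), pow_succ' (generatorFinite e x), Module.End.mul_apply,
      Module.End.mul_apply, generatorFinite_neg]
    have h : (generatorFinite e (-x) ^ k) f = (generatorFinite e x ^ k) f <• ((-1 : ℍ) ^ k) :=
      Subtype.ext ih
    rw [← generatorFinite_neg, h, generatorFinite_neg, LinearMap.neg_apply, map_smul, pow_succ]
    simp

/-- Each Aᵏ moves onto f with sign (−1)ᵏ, giving the series of −A at f. Thus the sum at φ, for any φ
where the series converges, is determined by finite vectors. -/
theorem qinner_of_mem_expSeriesGraph {x : ℍ} {φ η : H}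
    (h : (φ, η) ∈ expSeriesGraph (generator e x)) (f : finiteVectors e) :
    qinner (f : H) η = qinner (expFinite e (-x) f) φ := by
  obtain ⟨v, rfl, hv, hη⟩ := h
  refine (hasSum_qinner_right (f : H) hη).unique ?_
  convert! hasSum_qinner_left (v 0) (hasSum_expFinite (-x) f) using 2 with k
  have h1 := qinner_generatorFinite_pow hv k 0 f
  rw [zero_add] at h1
  rw [expTerm, generatorFinite_neg_pow, smul_qinner, smul_qinner, qinner_smul, h1,
    Quaternion.star_coe, Quaternion.coe_commutes]
  simp

/-- This is the binomial expansion of (−1 + 1)ⁿ divided by n!. -/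
theorem sum_antidiagonal_factorial (n : ℕ) :
    ∑ p ∈ Finset.HasAntidiagonal.antidiagonal n,
      (-1 : ℝ) ^ p.1 * (p.1.factorial : ℝ)⁻¹ * (p.2.factorial : ℝ)⁻¹ = if n = 0 then 1 else 0 := by
  have h := (Commute.all (-1 : ℝ) 1).add_pow' n
  rw [neg_add_cancel, zero_pow_eq] at h
  have hn : (n.factorial : ℝ) ≠ 0 := by positivity
  rw [← mul_right_inj' hn, Finset.mul_sum]
  trans (if n = 0 then 1 else 0)
  · rw [h]
    refine Finset.sum_congr rfl fun p hp => ?_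
    obtain rfl := Finset.HasAntidiagonal.mem_antidiagonal.1 hp
    rw [Nat.choose_symm_add, Nat.add_choose, nsmul_eq_mul,
      Nat.cast_div (Nat.factorial_mul_factorial_dvd_factorial_add _ _) (by positivity)]
    push_cast
    field_simp
    simp
  · split_ifs with h0 <;> simp [h0]

/-- The exponential series of the generator preserves the inner product. -/
theorem qinner_expFinite (x : ℍ) (f g : finiteVectors e) :
    qinner (expFinite e x f) (expFinite e x g) = qinner (f : H) (g : H) := by
  -- In the Cauchy product, skewness turns the (i, j) term into (−1)ⁱ/(i! j!) ⟨f | Aⁿ g⟩ with n = i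
  -- + j, and these cancel on every antidiagonal except n = 0.
  refine (hasSum_qinner_antidiagonal (summable_norm_expTerm x f) (summable_norm_expTerm x g)
    (hasSum_expFinite x f) (hasSum_expFinite x g)).unique ?_
  have hv : ∀ k, (((generatorFinite e x ^ k) g : H), ((generatorFinite e x ^ (k + 1)) g : H)) ∈
      (generator e x).graph := fun k => by
    rw [pow_succ', Module.End.mul_apply]
    exact generatorFinite_mem_graph x _
  have hterm : ∀ n, ∑ p ∈ Finset.HasAntidiagonal.antidiagonal n,
      qinner (expTerm e x f p.1) (expTerm e x g p.2) =
        if n = 0 then qinner (f : H) (g : H) else 0 := fun n => by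
    have h1 : ∀ p ∈ Finset.HasAntidiagonal.antidiagonal n,
        qinner (expTerm e x f p.1) (expTerm e x g p.2) =
          (((-1 : ℝ) ^ p.1 * (p.1.factorial : ℝ)⁻¹ * (p.2.factorial : ℝ)⁻¹ : ℝ) : ℍ) *
            qinner (f : H) ((generatorFinite e x ^ n) g : H) := fun p hp => by
      have h2 := qinner_generatorFinite_pow hv p.1 p.2 f
      rw [add_comm p.2 p.1, Finset.HasAntidiagonal.mem_antidiagonal.1 hp] at h2
      rw [expTerm, expTerm, smul_qinner, qinner_smul, h2, Quaternion.star_coe,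
        ← Quaternion.coe_commutes]
      have h3 : ((-1 : ℍ)) ^ p.1 = (((-1 : ℝ) ^ p.1 : ℝ) : ℍ) := by simp
      rw [h3, ← mul_assoc, ← mul_assoc]
      simp only [← Quaternion.coe_mul]
      congr 2
      have h4 : ((-1 : ℝ) ^ p.1) * (-1 : ℝ) ^ p.1 = 1 := by rw [← mul_pow]; simp
      linear_combination (-(p.1.factorial : ℝ)⁻¹ * (p.2.factorial : ℝ)⁻¹) * h4
    have hsum := (map_sum (algebraMap ℝ ℍ) (fun p : ℕ × ℕ =>
      (-1 : ℝ) ^ p.1 * (p.1.factorial : ℝ)⁻¹ * (p.2.factorial : ℝ)⁻¹)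
      (Finset.HasAntidiagonal.antidiagonal n)).symm
    rw [sum_antidiagonal_factorial, Quaternion.algebraMap_def] at hsum
    rw [Finset.sum_congr rfl h1, ← Finset.sum_mul, hsum]
    split_ifs with h0 <;> simp [h0]
  simp only [hterm]
  exact hasSum_ite_eq 0 _

end Exponential

/-! ### The displacement operator as a unitary map, and conjugation by it. -/

section Displacement

variable {H : Type*} [NormedAddCommGroup H] [RightInnerProductSpace H] [CompleteSpace H]
  {e : HilbertSeqBasis H}

theorem isometry_expFinite (x : ℍ) : Isometry (expFinite e x) :=
  AddMonoidHomClass.isometry_of_norm _ fun f => by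
    have h := qinner_expFinite x f f
    rw [qinner_self, qinner_self] at h
    exact (sq_eq_sq₀ (norm_nonneg _) (norm_nonneg _)).1 (Quaternion.coe_injective h)

variable (e) in
/-- The unitary operator extending the exponential series of the generator. -/
def expMap (x : ℍ) : H → H :=
  (isUniformInducing_val (finiteVectors e : Set H)).isDenseInducing
    (denseRange_finiteVectors e) |>.extend (expFinite e x)

theorem continuous_expMap (x : ℍ) : Continuous (expMap e x) :=
  (uniformContinuous_uniformly_extend (isUniformInducing_val (finiteVectors e : Set H))
    (denseRange_finiteVectors e) (isometry_expFinite x).uniformContinuous).continuous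

theorem expMap_coe (x : ℍ) (f : finiteVectors e) : expMap e x (f : H) = expFinite e x f :=
  uniformly_extend_of_ind (isUniformInducing_val (finiteVectors e : Set H))
    (denseRange_finiteVectors e) (isometry_expFinite x).uniformContinuous f

/-- Both vectors have the same inner products with finite vectors, computed through the exponential
for −x. -/
theorem eq_expMap_of_mem_expSeriesGraph {x : ℍ} {φ η : H}
    (h : (φ, η) ∈ expSeriesGraph (generator e x)) : η = expMap e x φ := by
  have h1 : ∀ f : finiteVectors e, ∀ φ : H,
      qinner (f : H) (expMap e x φ) = qinner (expFinite e (-x) f) φ := fun f φ =>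
    (denseRange_finiteVectors e).induction_on
      (p := fun φ => qinner (f : H) (expMap e x φ) = qinner (expFinite e (-x) f) φ) φ
      (isClosed_eq ((continuous_qinner_right _).comp (continuous_expMap x))
        (continuous_qinner_right _)) fun g => by
      rw [expMap_coe, qinner_of_mem_expSeriesGraph (expFinite_mem_expSeriesGraph x g)]
  exact ext_qinner_finiteVectors fun f => by rw [h1, qinner_of_mem_expSeriesGraph h]

theorem qinner_expMap (x : ℍ) (φ ψ : H) :
    qinner (expMap e x φ) (expMap e x ψ) = qinner φ ψ := by
  refine (denseRange_finiteVectors e).induction_on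
    (p := fun φ => qinner (expMap e x φ) (expMap e x ψ) = qinner φ ψ) φ
    (isClosed_eq ((continuous_qinner_left _).comp (continuous_expMap x))
      (continuous_qinner_left _)) fun f => ?_
  refine (denseRange_finiteVectors e).induction_on
    (p := fun ψ => qinner (expMap e x f) (expMap e x ψ) = qinner (f : H) ψ) ψ
    (isClosed_eq ((continuous_qinner_right _).comp (continuous_expMap x))
      (continuous_qinner_right _)) fun g => ?_
  rw [expMap_coe, expMap_coe, qinner_expFinite]

theorem qinner_expMap_right (x : ℍ) (φ ψ : H) :
    qinner φ (expMap e x ψ) = qinner (expMap e (-x) φ) ψ := by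
  refine (denseRange_finiteVectors e).induction_on
    (p := fun φ => qinner φ (expMap e x ψ) = qinner (expMap e (-x) φ) ψ) φ
    (isClosed_eq (continuous_qinner_left _)
      ((continuous_qinner_left _).comp (continuous_expMap (-x)))) fun f => ?_
  refine (denseRange_finiteVectors e).induction_on
    (p := fun ψ => qinner (f : H) (expMap e x ψ) = qinner (expMap e (-x) f) ψ) ψ
    (isClosed_eq ((continuous_qinner_right _).comp (continuous_expMap x))
      (continuous_qinner_right _)) fun g => ?_
  rw [expMap_coe, expMap_coe, qinner_of_mem_expSeriesGraph (expFinite_mem_expSeriesGraph x g)]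

theorem expMap_neg_expMap (x : ℍ) (φ : H) : expMap e (-x) (expMap e x φ) = φ :=
  ext_qinner_basis (e := e) fun n => by rw [qinner_expMap_right, neg_neg, qinner_expMap]

/-- Additivity follows from the adjoint relation, with no appeal to the construction of the
extension. -/
theorem expMap_add (x : ℍ) (φ ψ : H) : expMap e x (φ + ψ) = expMap e x φ + expMap e x ψ :=
  ext_qinner_basis (e := e) fun n => by simp only [qinner_expMap_right, qinner_add]

theorem expMap_zero_right (x : ℍ) : expMap e x (0 : H) = 0 := by
  simpa using expMap_add (e := e) x 0 0

/-- The graph of the continuous `expMap` is closed and contains the series graph; conversely, its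
points over the dense finite vectors lie in the series graph. -/
theorem topologicalClosure_expSeriesGraph (x : ℍ) (p : H × H) :
    p ∈ (expSeriesGraph (generator e x)).topologicalClosure ↔ p.2 = expMap e x p.1 := by
  constructor
  · intro hp
    exact closure_minimal (t := {p : H × H | p.2 = expMap e x p.1})
      (fun p hp => eq_expMap_of_mem_expSeriesGraph hp)
      (isClosed_eq continuous_snd ((continuous_expMap x).comp continuous_fst)) hp
  · obtain ⟨φ, η⟩ := p
    intro h
    obtain rfl : η = expMap e x φ := h
    refine (denseRange_finiteVectors e).induction_on
      (p := fun φ => (φ, expMap e x φ) ∈ closure (expSeriesGraph (generator e x) : Set (H × H))) φ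
      (isClosed_closure.preimage (continuous_id.prodMk (continuous_expMap x))) fun f => ?_
    rw [expMap_coe]
    exact subset_closure (expFinite_mem_expSeriesGraph x f)

theorem mem_graph_displacement {x : ℍ} {φ η : H} :
    (φ, η) ∈ (displacement e x).graph ↔ η = expMap e x φ := by
  change (φ, η) ∈ (expSeriesGraph (generator e x)).topologicalClosure.toLinearPMap.graph ↔ _
  rw [Submodule.toLinearPMap_graph_eq, topologicalClosure_expSeriesGraph]
  intro p hp h0
  rw [(topologicalClosure_expSeriesGraph x p).1 hp, h0, expMap_zero_right]

theorem mem_graph_opAdjoint_displacement {x : ℍ} {φ η : H} :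
    (φ, η) ∈ (opAdjoint (displacement e x)).graph ↔ η = expMap e (-x) φ := by
  have key : ∀ p : H × H, (∀ ψ : (displacement e x).domain,
      qinner p.2 (ψ : H) = qinner p.1 (displacement e x ψ)) ↔ p.2 = expMap e (-x) p.1 := by
    intro p
    constructor
    · intro h
      refine ext_qinner_basis (e := e) fun n => ?_
      have hn : (e n, expMap e x (e n)) ∈ (displacement e x).graph := mem_graph_displacement.2 rfl
      obtain ⟨ψ, hψ, hψ'⟩ := (LinearPMap.mem_graph_iff _).1 hn
      have h1 := h ψ
      simp only at hψ hψ'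
      rw [hψ, hψ', qinner_expMap_right] at h1
      rw [← star_qinner, h1, star_qinner]
    · intro h ψ
      rw [h, mem_graph_displacement.1 (LinearPMap.mem_graph _ ψ), qinner_expMap_right]
  rw [opAdjoint, Submodule.toLinearPMap_graph_eq]
  · exact key (φ, η)
  · intro p hp h0
    rw [(key p).1 hp, h0, expMap_zero_right]

theorem continuous_leftMul (q : ℍ) : Continuous (leftMul e q) :=
  AddMonoidHomClass.continuous_of_bound (leftMul e q) ‖q‖ (norm_leftMul_le q)

theorem leftMul_neg (q : ℍ) (φ : H) : leftMul e (-q) φ = -leftMul e q φ :=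
  ext_qinner_basis (e := e) fun n => by
    rw [qinner_leftMul, qinner_neg, qinner_leftMul, neg_mul]

theorem expFinite_mulFinite {x q : ℍ} (h : q * x = x * q) (h' : q * star x = star x * q)
    (f : finiteVectors e) : expFinite e x (mulFinite e q f) = leftMul e q (expFinite e x f) := by
  refine (hasSum_expFinite x _).unique ?_
  convert! (hasSum_expFinite x f).map (leftMul e q) (continuous_leftMul q) using 1
  funext k
  have hk : mulFinite e q * generatorFinite e x ^ k = generatorFinite e x ^ k * mulFinite e q :=
    Commute.pow_right (mulFinite_mul_generatorFinite (e := e) h h') k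
  have hf := LinearMap.congr_fun hk f
  simp only [Module.End.mul_apply] at hf
  rw [Function.comp_apply, expTerm, expTerm, leftMul_smul, ← hf, coe_mulFinite]

theorem expMap_leftMul {x q : ℍ} (h : q * x = x * q) (h' : q * star x = star x * q) (φ : H) :
    expMap e x (leftMul e q φ) = leftMul e q (expMap e x φ) :=
  (denseRange_finiteVectors e).induction_on
    (p := fun φ => expMap e x (leftMul e q φ) = leftMul e q (expMap e x φ)) φ
    (isClosed_eq ((continuous_expMap x).comp (continuous_leftMul q))
      ((continuous_leftMul q).comp (continuous_expMap x))) fun f => by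
    rw [← coe_mulFinite, expMap_coe, expMap_coe, expFinite_mulFinite h h']

/-- An operator that maps finite vectors to finite vectors by `S` and is the closure of `S`. -/
structure IsClosureOfFinite (T : H →ₗ.[ℍᵐᵒᵖ] H) (S : Module.End ℍᵐᵒᵖ (finiteVectors e)) :
    Prop where
  isClosed : IsClosed (T.graph : Set (H × H))
  mem_graph : ∀ f : finiteVectors e, ((f : H), (S f : H)) ∈ T.graph
  core : ∀ φ η, (φ, η) ∈ T.graph → ∃ f : ℕ → finiteVectors e,
    Tendsto (fun n => (f n : H)) atTop (𝓝 φ) ∧ Tendsto (fun n => (S (f n) : H)) atTop (𝓝 η)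

theorem isClosureOfFinite_annihilation : IsClosureOfFinite (annihilation e) (annFinite e) where
  isClosed := (isWeightedShift_annihilation e).isClosed_graph
  mem_graph := annFinite_mem_graph
  core φ η h := by
    -- Lowering the truncation of φ at N + 1 gives the truncation of η at N.
    refine ⟨fun N => truncation e (N + 1) φ,
      (tendsto_add_atTop_iff_nat 1).2 (tendsto_truncation e φ), ?_⟩
    convert! tendsto_truncation e η using 2 with N
    refine ext_qinner_basis (e := e) fun n => ?_
    rw [qinner_annFinite, qinner_truncation, qinner_truncation,
      (isWeightedShift_annihilation e φ η).1 h, mul_ite, mul_zero]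
    simp only [Nat.add_lt_add_iff_right]

theorem isClosureOfFinite_creation : IsClosureOfFinite (creation e) (creFinite e) where
  isClosed := (isWeightedShift_creation e).isClosed_graph
  mem_graph := creFinite_mem_graph
  core φ η h := by
    -- Raising the truncation of φ at N gives the truncation of η at N + 1.
    refine ⟨fun N => truncation e N φ, tendsto_truncation e φ, ?_⟩
    convert! (tendsto_add_atTop_iff_nat 1).2 (tendsto_truncation e η) using 2 with N
    refine ext_qinner_basis (e := e) fun n => ?_
    rw [qinner_creFinite, qinner_truncation, qinner_truncation,
      (isWeightedShift_creation e φ η).1 h, mul_ite, mul_zero]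
    rcases n with _ | n
    · simp
    · simp only [Nat.add_sub_cancel, Nat.add_lt_add_iff_right]

variable {T : H →ₗ.[ℍᵐᵒᵖ] H} {S : Module.End ℍᵐᵒᵖ (finiteVectors e)}

/-- With the zeroth term split off, the commutator identity applies to Aᵏ⁺¹, and (k + 1)/(k + 1)! =
1/k! turns the extra terms into q times the exponential series of f. -/
theorem hasSum_apply_expTerm {x q : ℍ} (h : q * x = x * q) (h' : q * star x = star x * q)
    (hS : S * generatorFinite e x = generatorFinite e x * S + mulFinite e q)
    (f : finiteVectors e) :
    HasSum (fun k => (S ((generatorFinite e x ^ k) f) : H) <• (((k.factorial : ℝ)⁻¹ : ℝ) : ℍ))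
      (expFinite e x (S f) + leftMul e q (expFinite e x f)) := by
  have h1 := hasSum_expFinite x (S f)
  rw [← hasSum_nat_add_iff' 1] at h1 ⊢
  have h2 := h1.add ((hasSum_expFinite x f).map (leftMul e q) (continuous_leftMul q))
  convert! h2 using 1
  · funext k
    have hk := LinearMap.congr_fun
      (mul_pow_of_mul_eq_add (R := Module.End ℍᵐᵒᵖ (finiteVectors e)) hS
        (mulFinite_mul_generatorFinite h h') k) f
    simp only [Module.End.mul_apply, LinearMap.add_apply, LinearMap.smul_apply] at hk
    rw [hk, Function.comp_apply, expTerm, expTerm, leftMul_smul, Submodule.coe_add, smul_add]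
    congr 1
    rw [AddSubmonoidClass.coe_nsmul, coe_mulFinite, ← Nat.cast_smul_eq_nsmul ℍᵐᵒᵖ,
      ← MulOpposite.op_natCast, ← mul_smul, ← MulOpposite.op_mul, ← Quaternion.coe_natCast,
      ← Quaternion.coe_mul, Nat.factorial_succ]
    congr 3
    push_cast
    field_simp
  · simp [expTerm]
    abel

/-- Closedness of T is used twice: to pass from partial sums to the exponential of a finite vector,
and from finite vectors to φ by the core property. -/
theorem expMap_mem_graph (hT : IsClosureOfFinite T S) {x q : ℍ} (h : q * x = x * q)
    (h' : q * star x = star x * q)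
    (hS : S * generatorFinite e x = generatorFinite e x * S + mulFinite e q) {φ η : H}
    (hφ : (φ, η) ∈ T.graph) :
    (expMap e x φ, expMap e x η + leftMul e q (expMap e x φ)) ∈ T.graph := by
  have hfin : ∀ f : finiteVectors e,
      (expMap e x (f : H), expMap e x (S f : H) + leftMul e q (expMap e x (f : H))) ∈ T.graph := by
    intro f
    rw [expMap_coe, expMap_coe]
    exact hT.isClosed.mem_of_tendsto
      ((hasSum_expFinite x f).prodMk (hasSum_apply_expTerm h h' hS f))
      (Eventually.of_forall fun s => Submodule.sum_mem _ fun k _ =>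
        Submodule.smul_mem _ _ (hT.mem_graph _))
  obtain ⟨f, hf, hSf⟩ := hT.core φ η hφ
  have h1 := ((continuous_expMap (e := e) x).tendsto φ).comp hf
  have h2 := ((continuous_expMap (e := e) x).tendsto η).comp hSf
  exact hT.isClosed.mem_of_tendsto
    (h1.prodMk_nhds (h2.add (((continuous_leftMul q).tendsto _).comp h1)))
    (Eventually.of_forall fun n => hfin (f n))

theorem opAdjoint_displacement_comp (hT : IsClosureOfFinite T S) {x q : ℍ} (h : q * x = x * q)
    (h' : q * star x = star x * q)
    (hS : S * generatorFinite e x = generatorFinite e x * S + mulFinite e q)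
    (hS' : S * generatorFinite e (-x) = generatorFinite e (-x) * S + mulFinite e (-q)) :
    opComp (opAdjoint (displacement e x)) (opComp T (displacement e x)) =
      T + (leftMul e q).toPMap ⊤ := by
  refine LinearPMap.eq_of_eq_graph (Submodule.ext fun ⟨φ, η⟩ => ?_)
  simp only [mem_graph_opComp, mem_graph_add, mem_graph_displacement,
    mem_graph_opAdjoint_displacement, mem_graph_toPMap_top]
  constructor
  · rintro ⟨χ, ⟨_, rfl, hχ⟩, rfl⟩
    -- Here only D φ is known to lie in the domain of T; transporting it back by the exponential for
    -- −x puts φ itself there.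
    have h1 := expMap_mem_graph hT (x := -x) (q := -q) (by simp [h]) (by simp [h']) hS' hχ
    rw [expMap_neg_expMap, leftMul_neg] at h1
    exact ⟨_, _, h1, rfl, by abel⟩
  · rintro ⟨α, _, hα, rfl, rfl⟩
    refine ⟨_, ⟨_, rfl, expMap_mem_graph hT h h' hS hα⟩, ?_⟩
    rw [← expMap_leftMul h h', ← expMap_add, expMap_neg_expMap]

end Displacement

end Quaternionic

end

theorem mainTheorem8 {H : Type*} [NormedAddCommGroup H] [Quaternionic.RightInnerProductSpace H]
    [CompleteSpace H] (e : Quaternionic.HilbertSeqBasis H) (x : ℍ) :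
    Quaternionic.opComp (Quaternionic.opAdjoint (Quaternionic.displacement e x))
        (Quaternionic.opComp (Quaternionic.annihilation e) (Quaternionic.displacement e x)) =
      Quaternionic.annihilation e + (Quaternionic.leftMul e x).toPMap ⊤ ∧
    Quaternionic.opComp (Quaternionic.opAdjoint (Quaternionic.displacement e x))
        (Quaternionic.opComp (Quaternionic.creation e) (Quaternionic.displacement e x)) =
      Quaternionic.creation e + (Quaternionic.leftMul e (star x)).toPMap ⊤ := by
  -- Needed because q is x for a and x̄ for a†, and each must commute with both x and x̄.
  have h : star x * x = x * star x := by rw [Quaternion.star_mul_self, Quaternion.self_mul_star]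
  refine ⟨Quaternionic.opAdjoint_displacement_comp Quaternionic.isClosureOfFinite_annihilation rfl
    h.symm (Quaternionic.annFinite_mul_generatorFinite x)
    (Quaternionic.annFinite_mul_generatorFinite (-x)),
    Quaternionic.opAdjoint_displacement_comp Quaternionic.isClosureOfFinite_creation h rfl
    (Quaternionic.creFinite_mul_generatorFinite x) ?_⟩
  rw [Quaternionic.creFinite_mul_generatorFinite, star_neg]
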